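/- For a prime number $p$ let $R=\{x^2 : x\in\mathbb{F}_p^*\}\subseteq\mathbb{F}_p$ be the set of non-zero quadratic residues modulo $p$, and let $d(p)$ be the length of the longest run of consecutive quadratic residues modulo $p$, that is, the largest integer $n\ge 0$ such that $\{a,a+1,\dots,a+n-1\}\subseteq R$ for some $a\in\mathbb{F}_p$. Then $d(p)\ll p^{1/4}\log p$; that is, there is an absolute constant $C>0$ such that for every prime $p$ $$d(p)\le C\,p^{1/4}\log_2 p .$$ -/

import Mathlib

/-- The set `R = {x² : x ∈ 𝔽_p^*}` of (nonzero) quadratic residues modulo `p`. -/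
def quadResidues (p : ℕ) : Set (ZMod p) :=
  {y | ∃ x : ZMod p, x ≠ 0 ∧ y = x ^ 2}

/-- The lengths `n` for which some block `a, a + 1, …, a + (n - 1)` of residue classes modulo `p`
consists of quadratic residues only. -/
def residueRunLengths (p : ℕ) : Set ℕ :=
  {n | ∃ a : ZMod p, ∀ i : ℕ, i < n → a + (i : ZMod p) ∈ quadResidues p}

/-- The length `d(p)` of the longest run of consecutive quadratic residues modulo `p`. -/
noncomputable def longestResidueRun (p : ℕ) : ℕ :=
  sSup (residueRunLengths p)

/-- For prime `p` the supremum defining `d(p)` is a maximum. -/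
theorem longestResidueRun_isGreatest (p : ℕ) (hp : p.Prime) :
    IsGreatest (residueRunLengths p) (longestResidueRun p) := by
  haveI : Fact p.Prime := ⟨hp⟩
  have hne : (residueRunLengths p).Nonempty := ⟨0, 0, fun i hi => absurd hi (Nat.not_lt_zero i)⟩
  have hbdd : BddAbove (residueRunLengths p) := by
    refine ⟨p, ?_⟩
    rintro n ⟨a, ha⟩
    by_contra! hlt
    obtain ⟨x, hx, hx2⟩ := ha (-a).val ((ZMod.val_lt (-a)).trans hlt)
    rw [ZMod.natCast_zmod_val, add_neg_cancel] at hx2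
    exact pow_ne_zero 2 hx hx2.symm
  exact ⟨Nat.sSup_mem hne hbdd, fun n hn => le_csSup hbdd hn⟩

/-! This is Burgess's shift argument combined with a Weil bound. Let χ be the quadratic character,
and suppose χ = 1 on a + i for all i < L + hQ. For i < L, 1 ≤ q ≤ Q and x = (a + i)/q, one has χ(x +
j) = χ((a + i + jq)/q) = χ(q) for 1 ≤ j ≤ h, so x starts a run of constant character.

Such x are rare. Expanding ∏ (1 + χ(c(x + j))) over subsets and applying Weil's bound, there are at
most p/2^h + 23h√p of them for each sign (`card_residueShifts_le`). Yet the x are numerous: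
Dirichlet approximation replaces a by a fraction u/w for which coincidences mod p lift to ℤ
(`exists_coprime_lift`), so reduced fractions (u + iw)/q give distinct points, and at least LQ/8
pairs are reduced (`mul_le_card_coprime_pairs`). Taking h ≈ log₂ p, Q ≈ p^{1/4} and L = 2000hQ gives
a contradiction.

The Weil bound comes from Stepanov's method: a nonzero polynomial of small degree vanishing to order
M wherever f^{(p-1)/2} = 1 limits how often f is a nonzero square (`mul_card_filter_pow_eq_one_le`).
-/

/-! ### Stepanov's method: the auxiliary polynomial -/

open Polynomial in
/-- The linear operator `u ↦ v` determined by `(f ^ a * u)^(l) = f ^ (a - l) * v`. -/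
noncomputable def derivFactor {F : Type*} [Field F] (f : F[X]) (a : ℕ) : ℕ → F[X] →ₗ[F] F[X]
  | 0 => LinearMap.id
  | l + 1 =>
    LinearMap.mulLeft F (((a - l : ℕ) : F[X]) * derivative f) ∘ₗ derivFactor f a l +
      LinearMap.mulLeft F f ∘ₗ derivative ∘ₗ derivFactor f a l

section Stepanov

open Polynomial

variable {F : Type*} [Field F]

theorem iterate_derivative_pow_mul (f u : F[X]) (a : ℕ) :
    ∀ l ≤ a, derivative^[l] (f ^ a * u) = f ^ (a - l) * derivFactor f a l u := by
  intro l
  induction l with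
  | zero => intro _; simp [derivFactor]
  | succ l ih =>
    intro hl
    obtain ⟨b, hb⟩ : ∃ b, a - l = b + 1 := ⟨a - l - 1, by omega⟩
    have hb' : a - (l + 1) = b := by omega
    rw [Function.iterate_succ_apply', ih (by omega), hb', derivFactor, hb]
    simp only [derivative_mul, derivative_pow, LinearMap.add_apply, LinearMap.comp_apply,
      LinearMap.mulLeft_apply]
    simp only [Nat.add_sub_cancel, map_natCast]
    ring

theorem natDegree_derivFactor_le (f u : F[X]) (a l : ℕ) :
    (derivFactor f a l u).natDegree ≤ u.natDegree + l * f.natDegree := by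
  induction l with
  | zero => simp [derivFactor]
  | succ l ih =>
    rw [derivFactor]
    simp only [LinearMap.add_apply, LinearMap.comp_apply, LinearMap.mulLeft_apply]
    have h1 := natDegree_derivative_le f
    have h2 := natDegree_derivative_le (derivFactor f a l u)
    have h3 : ((((a - l : ℕ) : F[X]) * derivative f)).natDegree ≤ f.natDegree := by
      refine natDegree_mul_le.trans ?_
      rw [natDegree_natCast]; omega
    refine (natDegree_add_le _ _).trans (max_le ?_ ?_)
    · refine natDegree_mul_le.trans ?_
      rw [add_mul]; omega
    · refine natDegree_mul_le.trans ?_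
      rw [add_mul]; omega

theorem iterate_derivative_mul_X_pow_char (p : ℕ) [CharP F p] (u : F[X]) (j l : ℕ) :
    derivative^[l] (u * X ^ (p * j)) = derivative^[l] u * X ^ (p * j) := by
  induction l with
  | zero => rfl
  | succ l ih =>
    rw [Function.iterate_succ_apply', ih, Function.iterate_succ_apply', derivative_mul,
      derivative_X_pow]
    simp

/-- Parity of the multiplicity at α: odd on the left, even on the right. -/
theorem sq_mul_ne_const_mul_sq {f k k' : F[X]} {α : F} (hα : Odd (f.rootMultiplicity α)) (c : F)
    (hk : k ≠ 0) : k ^ 2 * f ≠ C c * k' ^ 2 := by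
  intro h
  have hf : f ≠ 0 := by
    rintro rfl
    simp at hα
  have hne : k ^ 2 * f ≠ 0 := mul_ne_zero (pow_ne_zero 2 hk) hf
  have hne' : C c * k' ^ 2 ≠ 0 := h ▸ hne
  have h1 := congrArg (rootMultiplicity α) h
  rw [rootMultiplicity_mul hne, rootMultiplicity_mul hne', rootMultiplicity_C,
    pow_two, rootMultiplicity_mul (by rw [← pow_two]; exact left_ne_zero_of_mul hne),
    pow_two, rootMultiplicity_mul (by rw [← pow_two]; exact right_ne_zero_of_mul hne')] at h1
  obtain ⟨r, hr⟩ := hα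
  omega

theorem X_pow_dvd_pow_sub_C {p : ℕ} [Fact p.Prime] (f : (ZMod p)[X]) :
    X ^ p ∣ f ^ p - C (f.eval 0) := by
  have h : f ^ p - C (f.eval 0) = (f - C (f.eval 0)) ^ p := by
    rw [sub_pow_char, ← C_pow, ZMod.pow_card]
  rw [h]
  apply pow_dvd_pow_of_dvd
  rw [X_dvd_iff]
  simp [coeff_zero_eq_eval_zero]

/-- Multiplying by the conjugate k - f^{(p-1)/2} k' and by f gives k² f - f^p k'², and f^p ≡ f(0)
mod X^p. The result k² f - f(0) k'² has degree below p, so it vanishes identically, against the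
parity of the multiplicity at α unless k = 0. -/
theorem eq_zero_of_X_pow_dvd_add_pow_mul {p K : ℕ} [Fact p.Prime] (hp : p ≠ 2)
    {f k k' : (ZMod p)[X]} {α : ZMod p} (hα : Odd (f.rootMultiplicity α)) (hf0 : f.eval 0 ≠ 0)
    (hk : k.natDegree < K) (hk' : k'.natDegree < K) (hK : 2 * K + f.natDegree ≤ p + 1)
    (h : X ^ p ∣ k + f ^ (p / 2) * k') : k = 0 ∧ k' = 0 := by
  have hodd : 2 * (p / 2) + 1 = p := by
    have := (Fact.out : p.Prime).eq_two_or_odd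
    omega
  have hfp : f ^ p = f ^ (p / 2) * f ^ (p / 2) * f := by
    rw [← pow_add, ← pow_succ]
    congr 1
    omega
  have h1 : X ^ p ∣ k ^ 2 * f - C (f.eval 0) * k' ^ 2 := by
    have e : k ^ 2 * f - C (f.eval 0) * k' ^ 2 =
        (k + f ^ (p / 2) * k') * ((k - f ^ (p / 2) * k') * f) +
          (f ^ p - C (f.eval 0)) * k' ^ 2 := by
      rw [hfp]; ring
    rw [e]
    exact dvd_add (h.mul_right _) ((X_pow_dvd_pow_sub_C f).mul_right _)
  have h2 : k ^ 2 * f - C (f.eval 0) * k' ^ 2 = 0 := by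
    by_contra hne
    have hd := natDegree_le_of_dvd h1 hne
    rw [natDegree_X_pow] at hd
    have a1 : (k ^ 2 * f).natDegree ≤ 2 * k.natDegree + f.natDegree :=
      natDegree_mul_le.trans (by gcongr; exact natDegree_pow_le)
    have a2 : (C (f.eval 0) * k' ^ 2).natDegree ≤ 2 * k'.natDegree :=
      (natDegree_C_mul_le _ _).trans natDegree_pow_le
    have a3 := natDegree_sub_le (k ^ 2 * f) (C (f.eval 0) * k' ^ 2)
    have a4 : 2 * k'.natDegree ≤ p - 1 := by omega
    have a5 : 2 * k.natDegree + f.natDegree ≤ p - 1 := by omega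
    have a6 := a3.trans (max_le (a1.trans a5) (a2.trans a4))
    omega
  have hk0 : k = 0 := by
    by_contra hk0
    exact sq_mul_ne_const_mul_sq hα _ hk0 (sub_eq_zero.mp h2)
  refine ⟨hk0, ?_⟩
  rw [hk0] at h2
  simpa [hf0] using h2

/-- Ensures that the auxiliary polynomial is nonzero. Once the terms below j vanish, those above are
divisible by X^{p(j+1)}, so X^p divides the j-th coefficient. -/
theorem eq_zero_of_sum_eq_zero {p K J : ℕ} [Fact p.Prime] (hp : p ≠ 2)
    {f : (ZMod p)[X]} {k k' : Fin J → (ZMod p)[X]} {α : ZMod p}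
    (hα : Odd (f.rootMultiplicity α)) (hf0 : f.eval 0 ≠ 0)
    (hk : ∀ j, (k j).natDegree < K) (hk' : ∀ j, (k' j).natDegree < K)
    (hK : 2 * K + f.natDegree ≤ p + 1)
    (h : ∑ j, (k j + f ^ (p / 2) * k' j) * X ^ (p * (j : ℕ)) = 0) (j : Fin J) :
    k j = 0 ∧ k' j = 0 := by
  induction j using WellFoundedLT.induction with
  | ind j ih =>
    refine eq_zero_of_X_pow_dvd_add_pow_mul hp hα hf0 (hk j) (hk' j) hK ?_
    rw [← mul_dvd_mul_iff_right (pow_ne_zero (p * (j : ℕ)) (X_ne_zero (R := ZMod p)))]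
    rw [← Finset.add_sum_erase _ _ (Finset.mem_univ j)] at h
    rw [eq_neg_of_add_eq_zero_left h, dvd_neg]
    refine Finset.dvd_sum fun i hi => ?_
    rcases lt_or_gt_of_ne (Finset.ne_of_mem_erase hi) with hij | hij
    · obtain ⟨h1, h2⟩ := ih i hij
      simp [h1, h2]
    · refine Dvd.dvd.mul_left ?_ _
      rw [← pow_add]
      refine pow_dvd_pow _ ?_
      calc p + p * (j : ℕ) = p * (j + 1) := by ring
        _ ≤ p * i := Nat.mul_le_mul_left _ hij

theorem exists_ne_zero_forall_apply_eq_zero {V : Type*} [AddCommGroup V] [Module F V]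
    [FiniteDimensional F V] {M D : ℕ} (Ψ : Fin M → V →ₗ[F] F[X])
    (hdeg : ∀ l v, (Ψ l v).natDegree < D) (hdim : M * D < Module.finrank F V) :
    ∃ v ≠ 0, ∀ l, Ψ l v = 0 := by
  let Φ : V →ₗ[F] (Fin M → Fin D → F) :=
    LinearMap.pi fun l => LinearMap.pi fun i => lcoeff F i ∘ₗ Ψ l
  have hlt : Module.finrank F (Fin M → Fin D → F) < Module.finrank F V := by
    simpa [Module.finrank_pi_fintype] using hdim
  obtain ⟨v, hv, hv0⟩ := Submodule.exists_mem_ne_zero_of_ne_bot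
    (LinearMap.ker_ne_bot_of_finrank_lt (f := Φ) hlt)
  refine ⟨v, hv0, fun l => ?_⟩
  ext i
  rw [coeff_zero]
  by_cases hi : i < D
  · simpa [Φ] using congrFun (congrFun (LinearMap.mem_ker.mp hv) l) ⟨i, hi⟩
  · exact coeff_eq_zero_of_natDegree_lt ((hdeg l v).trans_le (not_lt.mp hi))

/-- Linear algebra: 2JK unknown coefficients against M polynomial identities, each of degree less
than K + M deg f + J. -/
theorem exists_derivFactor_relation (f : F[X]) (b J K M : ℕ)
    (hdim : M * (K + M * f.natDegree + J) < 2 * (J * K)) :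
    ∃ k k' : Fin J → F[X], (∀ j, (k j).natDegree < K) ∧ (∀ j, (k' j).natDegree < K) ∧
      (∃ j, k j ≠ 0 ∨ k' j ≠ 0) ∧ ∀ l < M,
        ∑ j, (derivFactor f M l (k j) + derivFactor f (M + b) l (k' j)) * X ^ (j : ℕ) = 0 := by
  have hK0 : 0 < K := by
    rcases Nat.eq_zero_or_pos K with rfl | h
    · simp at hdim
    · exact h
  have : FiniteDimensional F (degreeLT F K) := Module.Finite.equiv (degreeLTEquiv F K).symm
  have hfin : Module.finrank F (degreeLT F K) = K := by
    rw [(degreeLTEquiv F K).finrank_eq, Module.finrank_fin_fun]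
  have hdeg : ∀ w : degreeLT F K, (w : F[X]).natDegree < K := fun w => by
    rcases eq_or_ne (w : F[X]) 0 with h | h
    · rwa [h, natDegree_zero]
    · exact (natDegree_lt_iff_degree_lt h).mpr (mem_degreeLT.mp w.2)
  obtain ⟨v, hv0, hv⟩ := exists_ne_zero_forall_apply_eq_zero (F := F) (M := M)
    (V := (Fin J → degreeLT F K) × (Fin J → degreeLT F K)) (D := K + M * f.natDegree + J)
    (fun l => ∑ j : Fin J, LinearMap.mulRight F (X ^ (j : ℕ)) ∘ₗ
      (derivFactor f M l ∘ₗ (degreeLT F K).subtype ∘ₗ LinearMap.proj j ∘ₗ LinearMap.fst F _ _ +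
        derivFactor f (M + b) l ∘ₗ (degreeLT F K).subtype ∘ₗ LinearMap.proj j ∘ₗ
          LinearMap.snd F _ _))
    (by
      intro l v
      simp only [LinearMap.sum_apply, LinearMap.comp_apply, LinearMap.add_apply,
        LinearMap.mulRight_apply, LinearMap.fst_apply, LinearMap.snd_apply, LinearMap.proj_apply,
        Submodule.subtype_apply]
      refine lt_of_le_of_lt (natDegree_sum_le_of_forall_le (n := K + M * f.natDegree + J - 1) _ _
        fun j _ => ?_) (by omega)
      refine natDegree_mul_le.trans ?_
      rw [natDegree_X_pow]
      have h1 := natDegree_derivFactor_le f (v.1 j) M l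
      have h2 := natDegree_derivFactor_le f (v.2 j) (M + b) l
      have h3 := natDegree_add_le (derivFactor f M l (v.1 j)) (derivFactor f (M + b) l (v.2 j))
      have h4 := hdeg (v.1 j)
      have h5 := hdeg (v.2 j)
      have h6 : l * f.natDegree ≤ M * f.natDegree := Nat.mul_le_mul_right _ l.2.le
      have h7 := j.2
      have h8 := h3.trans (max_le (c := K - 1 + M * f.natDegree) (by omega) (by omega))
      omega)
    (by
      rw [Module.finrank_prod, Module.finrank_pi_fintype]
      simp only [hfin, Finset.sum_const, Finset.card_univ, Fintype.card_fin, smul_eq_mul]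
      rwa [← two_mul])
  refine ⟨fun j => v.1 j, fun j => v.2 j, fun j => hdeg _, fun j => hdeg _, ?_, fun l hl => ?_⟩
  · by_contra! hall
    refine hv0 (Prod.ext (funext fun j => ?_) (funext fun j => ?_))
    · exact Subtype.ext (hall j).1
    · exact Subtype.ext (hall j).2
  · simpa using hv ⟨l, hl⟩

theorem card_mul_le_natDegree_of_le_rootMultiplicity {R : F[X]} (s : Finset F)
    {M : ℕ} (h : ∀ x ∈ s, M ≤ R.rootMultiplicity x) : M * s.card ≤ R.natDegree := by
  classical
  refine le_trans ?_ (card_roots' R)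
  have : M • s.val ≤ R.roots := by
    rw [Multiset.le_iff_count]
    intro x
    rw [Multiset.count_nsmul, count_roots]
    by_cases hx : x ∈ s
    · rw [Multiset.count_eq_one_of_mem s.nodup hx, mul_one]
      exact h x hx
    · rw [Multiset.count_eq_zero_of_notMem hx, mul_zero]
      exact Nat.zero_le _
  simpa using Multiset.card_le_card this

theorem mul_card_filter_pow_eq_one_le {p K J M : ℕ} [Fact p.Prime] (hp : p ≠ 2)
    {f : (ZMod p)[X]} {α : ZMod p} (hα : Odd (f.rootMultiplicity α)) (hf0 : f.eval 0 ≠ 0)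
    (hK : 2 * K + f.natDegree ≤ p + 1) (hM : M < p)
    (hdim : M * (K + M * f.natDegree + J) < 2 * (J * K)) :
    M * (Finset.univ.filter fun x : ZMod p => f.eval x ^ (p / 2) = 1).card ≤
      (M + p / 2) * f.natDegree + K + p * J := by
  obtain ⟨k, k', hk, hk', ⟨j₀, hj₀⟩, hrel⟩ := exists_derivFactor_relation f (p / 2) J K M hdim
  have hf : f ≠ 0 := by
    rintro rfl
    simp at hf0
  -- X^{pj} has zero derivative, and x^p = x on 𝔽_p. Hence where f(x)^{(p-1)/2} = 1, the l-th
  -- derivative is f(x)^{M-l} times the relation `hrel` evaluated at x.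
  let R := ∑ j, (f ^ M * k j + f ^ (M + p / 2) * k' j) * X ^ (p * (j : ℕ))
  have hR : R ≠ 0 := by
    intro h
    have h' : f ^ M * ∑ j, (k j + f ^ (p / 2) * k' j) * X ^ (p * (j : ℕ)) = 0 := by
      rw [← h, Finset.mul_sum]
      refine Finset.sum_congr rfl fun j _ => ?_
      rw [pow_add]; ring
    have := eq_zero_of_sum_eq_zero hp hα hf0 hk hk' hK
      ((mul_eq_zero.mp h').resolve_left (pow_ne_zero _ hf)) j₀
    tauto
  have hder : ∀ x : ZMod p, f.eval x ^ (p / 2) = 1 → ∀ l < M, (derivative^[l] R).IsRoot x := by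
    intro x hx l hl
    have h1 : derivative^[l] R = ∑ j, (f ^ (M - l) * derivFactor f M l (k j) +
        f ^ (M + p / 2 - l) * derivFactor f (M + p / 2) l (k' j)) * X ^ (p * (j : ℕ)) := by
      simp only [R]
      rw [iterate_derivative_sum]
      refine Finset.sum_congr rfl fun j _ => ?_
      rw [iterate_derivative_mul_X_pow_char, iterate_map_add,
        iterate_derivative_pow_mul f _ _ _ hl.le, iterate_derivative_pow_mul f _ _ _ (by omega)]
    have h2 := congrArg (eval x) (hrel l hl)
    rw [IsRoot, h1]
    have e : M + p / 2 - l = (M - l) + p / 2 := by omega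
    simp only [eval_finsetSum, eval_mul, eval_add, eval_pow, eval_X, eval_zero, e, pow_add, hx,
      mul_one, pow_mul, ZMod.pow_card] at h2 ⊢
    rw [← mul_zero (eval x f ^ (M - l)), ← h2, Finset.mul_sum]
    exact Finset.sum_congr rfl fun j _ => by ring
  have hmult : ∀ x ∈ Finset.univ.filter fun x : ZMod p => f.eval x ^ (p / 2) = 1,
      M ≤ R.rootMultiplicity x := by
    intro x hx
    rcases Nat.eq_zero_or_pos M with h0 | h0
    · omega
    -- In characteristic p, derivatives detect multiplicity M provided (M - 1)! ≠ 0, which `hM`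
    -- guarantees.
    have := lt_rootMultiplicity_of_isRoot_iterate_derivative_of_mem_nonZeroDivisors (n := M - 1) hR
      (fun l hl => hder x (Finset.mem_filter.mp hx).2 l (by omega)) ?_
    · omega
    · rw [mem_nonZeroDivisors_iff_ne_zero, Ne, CharP.cast_eq_zero_iff (ZMod p) p,
        (Fact.out : p.Prime).dvd_factorial]
      omega
  refine (card_mul_le_natDegree_of_le_rootMultiplicity _ hmult).trans ?_
  refine natDegree_sum_le_of_forall_le _ _ fun j _ => natDegree_mul_le.trans ?_
  rw [natDegree_X_pow]
  have hj : p * (j : ℕ) ≤ p * J := Nat.mul_le_mul_left _ j.2.le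
  have h1 : (f ^ M * k j).natDegree ≤ (M + p / 2) * f.natDegree + K := by
    refine natDegree_mul_le.trans (add_le_add (natDegree_pow_le.trans ?_) (hk j).le)
    gcongr
    omega
  have h2 : (f ^ (M + p / 2) * k' j).natDegree ≤ (M + p / 2) * f.natDegree + K :=
    natDegree_mul_le.trans (add_le_add natDegree_pow_le (hk' j).le)
  have h3 := (natDegree_add_le _ _).trans (max_le h1 h2)
  omega

end Stepanov

/-! ### Weil's bound for quadratic character sums -/

section CharacterSum

open Polynomial

theorem natDegree_pos_of_odd_rootMultiplicity {F : Type*} [Field F] {f : F[X]} {α : F}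
    (hα : Odd (f.rootMultiplicity α)) : 0 < f.natDegree := by
  have := card_mul_le_natDegree_of_le_rootMultiplicity (R := f) (M := 1) {α} (by
    intro x hx
    rw [Finset.mem_singleton.mp hx]
    exact hα.pos)
  rw [Finset.card_singleton] at this
  omega

theorem sum_quadraticChar_eval_add_le {p : ℕ} [Fact p.Prime] (hp : p ≠ 2) {f : (ZMod p)[X]}
    (hf : f ≠ 0) : ∑ x : ZMod p, quadraticChar (ZMod p) (f.eval x) + p ≤
      2 * (Finset.univ.filter fun x : ZMod p => f.eval x ^ (p / 2) = 1).card + f.natDegree := by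
  have hzero : (Finset.univ.filter fun x : ZMod p => f.eval x = 0).card ≤ f.natDegree := by
    have := card_mul_le_natDegree_of_le_rootMultiplicity (R := f) (M := 1)
      (Finset.univ.filter fun x : ZMod p => f.eval x = 0)
      fun x hx => (rootMultiplicity_pos hf).mpr (Finset.mem_filter.mp hx).2
    simpa using this
  have hpt : ∀ x : ZMod p, quadraticChar (ZMod p) (f.eval x) + 1 ≤
      2 * (if f.eval x ^ (p / 2) = 1 then 1 else 0) + (if f.eval x = 0 then 1 else 0) := by
    intro x
    have hpow := quadraticChar_eq_pow_of_char_ne_two' (F := ZMod p)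
      (by rwa [ZMod.ringChar_zmod_n]) (f.eval x)
    rw [ZMod.card] at hpow
    by_cases h0 : f.eval x = 0
    · rw [if_pos h0, h0, quadraticChar_zero]
      split_ifs <;> norm_num
    · rcases quadraticChar_dichotomy h0 with h | h
      · rw [h, Int.cast_one] at hpow
        rw [if_pos hpow.symm, if_neg h0, h]
        norm_num
      · rw [h]
        split_ifs <;> norm_num
  have hsum := Finset.sum_le_sum fun (x : ZMod p) (_ : x ∈ Finset.univ) => hpt x
  rw [Finset.sum_add_distrib, Finset.sum_add_distrib, ← Finset.mul_sum, Finset.sum_boole,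
    Finset.sum_boole] at hsum
  simp only [Finset.sum_const, Finset.card_univ, ZMod.card, nsmul_eq_mul, mul_one] at hsum
  have : ((Finset.univ.filter fun x : ZMod p => f.eval x = 0).card : ℤ) ≤ f.natDegree := by
    exact_mod_cast hzero
  linarith

theorem sum_quadraticChar_eval_le_of_natDegree_le {p : ℕ} [Fact p.Prime] (hp : p ≠ 2)
    {f : (ZMod p)[X]} {α : ZMod p} (hα : Odd (f.rootMultiplicity α)) (hf0 : f.eval 0 ≠ 0)
    (ht : 13 ≤ p.sqrt) (hm : f.natDegree ≤ p.sqrt) :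
    ∑ x : ZMod p, quadraticChar (ZMod p) (f.eval x) ≤ 23 * f.natDegree * p.sqrt := by
  have hf : f ≠ 0 := by
    rintro rfl
    simp at hf0
  have hm1 : 1 ≤ f.natDegree := natDegree_pos_of_odd_rootMultiplicity hα
  have hpt : p.sqrt * p.sqrt ≤ p := Nat.sqrt_le p
  have hpt' : p ≤ p.sqrt * p.sqrt + p.sqrt + p.sqrt := Nat.sqrt_le_add p
  have hsum := sum_quadraticChar_eval_add_le hp hf
  -- Write t = ⌊√p⌋ and m = deg f. In the dimension condition 2tK cancels, leaving 16mK ≈ 8mp to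
  -- beat 4mt² and smaller terms. The main term of the count is pJ/M = p/2 + 4pm/t, an excess of
  -- order m√p over p/2.
  have hbound := mul_card_filter_pow_eq_one_le (M := 2 * p.sqrt) (J := p.sqrt + 8 * f.natDegree)
    (K := (p - f.natDegree + 1) / 2) hp hα hf0
  generalize (Finset.univ.filter fun x : ZMod p => f.eval x ^ (p / 2) = 1).card = N at hsum hbound
  generalize f.natDegree = m at *
  generalize p.sqrt = t at *
  generalize ∑ x : ZMod p, quadraticChar (ZMod p) (f.eval x) = S at *
  have htt : 13 * t ≤ t * t := Nat.mul_le_mul_right _ ht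
  have hmp : m ≤ p := by omega
  obtain ⟨K, hKdef⟩ : ∃ K, K = (p - m + 1) / 2 := ⟨_, rfl⟩
  rw [← hKdef] at hbound
  have hK1 : 2 * K + m ≤ p + 1 := by omega
  have hK2 : p ≤ 2 * K + m := by omega
  have hN := hbound hK1 (by omega) (by
    have h1 : m * (t * t) ≤ m * (2 * K + m) := Nat.mul_le_mul_left _ (hpt.trans hK2)
    have h2 : m * m ≤ m * t := Nat.mul_le_mul_left _ hm
    have h3 : m * (13 * t) ≤ m * (t * t) := Nat.mul_le_mul_left _ htt
    have h4 : 1 * (t * t) ≤ m * (t * t) := Nat.mul_le_mul_right _ hm1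
    have h5 : 1 * t ≤ m * t := Nat.mul_le_mul_right _ hm1
    nlinarith)
  have hhalf : p / 2 * m * 2 ≤ p * m := by
    have : p / 2 * 2 ≤ p := Nat.div_mul_le_self p 2
    nlinarith
  have hN' : 2 * (t * N) * 2 ≤ 4 * t * m + p * m + (p + 1) + 2 * p * (t + 8 * m) := by
    nlinarith
  have hpm : p * m ≤ (t * t + t + t) * m := Nat.mul_le_mul_right _ hpt'
  have hp1 : p * 1 ≤ p * m := Nat.mul_le_mul_left _ hm1
  have h3 : m * (13 * t) ≤ m * (t * t) := Nat.mul_le_mul_left _ htt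
  have h5 : 1 * t ≤ m * t := Nat.mul_le_mul_right _ hm1
  zify at *
  have key : (t : ℤ) * S ≤ t * (23 * m * t) := by
    have h6 : (t : ℤ) * (S + p) ≤ t * (2 * N + m) := mul_le_mul_of_nonneg_left hsum (by positivity)
    nlinarith
  exact le_of_mul_le_mul_left key (by omega)

/-- Weil's bound, up to the constant, for the sum of the quadratic character over the values of a
polynomial. -/
theorem sum_quadraticChar_eval_le {p : ℕ} [Fact p.Prime] (hp : p ≠ 2)
    {f : (ZMod p)[X]} {α : ZMod p} (hα : Odd (f.rootMultiplicity α)) (hf0 : f.eval 0 ≠ 0) :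
    ((∑ x : ZMod p, quadraticChar (ZMod p) (f.eval x) : ℤ) : ℝ) ≤
      23 * f.natDegree * Real.sqrt p := by
  have hm1 : 1 ≤ f.natDegree := natDegree_pos_of_odd_rootMultiplicity hα
  have hm1' : (1 : ℝ) ≤ f.natDegree := by exact_mod_cast hm1
  have hsq : Real.sqrt p * Real.sqrt p = p := Real.mul_self_sqrt (by positivity)
  have hs0 : 0 ≤ Real.sqrt p := Real.sqrt_nonneg _
  have htriv : ((∑ x : ZMod p, quadraticChar (ZMod p) (f.eval x) : ℤ) : ℝ) ≤ p := by
    have : ∑ x : ZMod p, quadraticChar (ZMod p) (f.eval x) ≤ p := by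
      calc ∑ x : ZMod p, quadraticChar (ZMod p) (f.eval x) ≤ ∑ _x : ZMod p, (1 : ℤ) := by
            refine Finset.sum_le_sum fun x _ => ?_
            rcases quadraticChar_isQuadratic (ZMod p) (f.eval x) with h | h | h <;> rw [h] <;>
              norm_num
        _ = p := by simp [ZMod.card]
    exact_mod_cast this
  -- In the excluded ranges, √p < 13 or deg f > ⌊√p⌋, the trivial bound p is already at most 23 deg
  -- f √p.
  by_cases ht : 13 ≤ p.sqrt
  · by_cases hm : f.natDegree ≤ p.sqrt
    · have h := sum_quadraticChar_eval_le_of_natDegree_le hp hα hf0 ht hm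
      have h' : ((∑ x : ZMod p, quadraticChar (ZMod p) (f.eval x) : ℤ) : ℝ) ≤
          23 * f.natDegree * (p.sqrt : ℝ) := by exact_mod_cast h
      refine h'.trans ?_
      gcongr
      exact Real.nat_sqrt_le_real_sqrt
    · have h1 : Real.sqrt p ≤ p.sqrt + 1 := Real.real_sqrt_le_nat_sqrt_succ
      have h2 : (p.sqrt : ℝ) + 1 ≤ f.natDegree := by exact_mod_cast not_le.mp hm
      refine htriv.trans ?_
      nlinarith
  · have h1 : Real.sqrt p ≤ p.sqrt + 1 := Real.real_sqrt_le_nat_sqrt_succ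
    have h2 : (p.sqrt : ℝ) + 1 ≤ 13 := by exact_mod_cast not_le.mp ht
    refine htriv.trans ?_
    nlinarith

end CharacterSum

/-! ### Few points start runs of constant character -/

section Runs

open Polynomial in
-- As h < p, the roots -j are distinct, hence simple, and nonzero since j starts at 1; so Weil's
-- bound applies.
theorem sum_quadraticChar_prod_le {p h : ℕ} [Fact p.Prime] (hp : p ≠ 2) (hh : h < p)
    {c : ZMod p} (hc : c ≠ 0) {S : Finset ℕ} (hS : S ⊆ Finset.Icc 1 h) (hne : S.Nonempty) :
    ((∑ x : ZMod p, ∏ j ∈ S, quadraticChar (ZMod p) (c * (x + j)) : ℤ) : ℝ) ≤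
      23 * h * Real.sqrt p := by
  have hzero : ∀ j ∈ Finset.Icc 1 h, (j : ZMod p) ≠ 0 := by
    intro j hj h0
    rw [ZMod.natCast_eq_zero_iff] at h0
    rw [Finset.mem_Icc] at hj
    exact absurd (Nat.le_of_dvd (by omega) h0) (by omega)
  have hinj : ∀ i ∈ Finset.Icc 1 h, ∀ j ∈ Finset.Icc 1 h, (i : ZMod p) = j → i = j := by
    intro i hi j hj hij
    rw [Finset.mem_Icc] at hi hj
    rw [ZMod.natCast_eq_natCast_iff', Nat.mod_eq_of_lt (by omega), Nat.mod_eq_of_lt (by omega)]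
      at hij
    exact hij
  let f : (ZMod p)[X] := ∏ j ∈ S, C c * (X + C (j : ZMod p))
  have heval : ∀ x, f.eval x = ∏ j ∈ S, c * (x + j) := by
    intro x
    simp [f, eval_prod]
  have hdeg : f.natDegree ≤ h := by
    refine (natDegree_prod_le _ _).trans ?_
    calc ∑ j ∈ S, (C c * (X + C (j : ZMod p))).natDegree ≤ ∑ _j ∈ S, 1 :=
          Finset.sum_le_sum (f := fun j : ℕ => (C c * (X + C (j : ZMod p))).natDegree)
            fun j _ => (natDegree_C_mul_le _ _).trans (natDegree_X_add_C _).le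
      _ = S.card := by simp
      _ ≤ (Finset.Icc 1 h).card := Finset.card_le_card hS
      _ = h := by simp
  have hf0 : f.eval 0 ≠ 0 := by
    rw [heval]
    refine Finset.prod_ne_zero_iff.mpr fun j hj => mul_ne_zero hc ?_
    rw [zero_add]
    exact hzero j (hS hj)
  obtain ⟨j₀, hj₀⟩ := hne
  have hmult : f.rootMultiplicity (-(j₀ : ZMod p)) = 1 := by
    have hf : f ≠ 0 := by
      intro h0
      rw [h0] at hf0
      simp at hf0
    have hsplit : f = (X - C (-(j₀ : ZMod p))) *
        (C c * ∏ j ∈ S.erase j₀, C c * (X + C (j : ZMod p))) := by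
      simp only [f]
      rw [← Finset.mul_prod_erase S _ hj₀, C_neg]
      ring
    rw [hsplit] at hf ⊢
    rw [rootMultiplicity_mul hf, rootMultiplicity_X_sub_C_self, rootMultiplicity_eq_zero]
    rw [IsRoot, eval_mul, eval_prod, eval_C]
    refine mul_ne_zero hc (Finset.prod_ne_zero_iff.mpr fun j hj => ?_)
    rw [eval_mul, eval_add, eval_C, eval_C, eval_X]
    refine mul_ne_zero hc fun h0 => ?_
    rw [Finset.mem_erase] at hj
    exact hj.1 (hinj j (hS hj.2) j₀ (hS hj₀) (by linear_combination h0))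
  have h := sum_quadraticChar_eval_le hp (hmult ▸ odd_one) hf0
  simp only [heval, map_prod] at h
  refine h.trans ?_
  gcongr

open Classical in
/-- The set of `x` such that all `c * (x + j)` with `1 ≤ j ≤ h` are quadratic residues. -/
noncomputable def residueShifts (p h : ℕ) [Fact p.Prime] (c : ZMod p) : Finset (ZMod p) :=
  Finset.univ.filter fun x => ∀ j : ℕ, j ∈ Finset.Icc 1 h →
    quadraticChar (ZMod p) (c * (x + j)) = 1

theorem mem_residueShifts {p h : ℕ} [Fact p.Prime] {c x : ZMod p} :
    x ∈ residueShifts p h c ↔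
      ∀ j : ℕ, j ∈ Finset.Icc 1 h → quadraticChar (ZMod p) (c * (x + j)) = 1 := by
  simp only [residueShifts, Finset.mem_filter, Finset.mem_univ, true_and]

/-- The product ∏ (1 + χ(c(x + j))) is 2^h on the set and nonnegative elsewhere. Upon expansion the
empty subset contributes p, and each other subset is a Weil sum. -/
theorem card_residueShifts_le {p h : ℕ} [Fact p.Prime] (hp : p ≠ 2) (hh : h < p)
    {c : ZMod p} (hc : c ≠ 0) :
    2 ^ h * ((residueShifts p h c).card : ℝ) ≤
        p + 2 ^ h * (23 * h * Real.sqrt p) := by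
  have hlow : 2 ^ h * ((residueShifts p h c).card : ℤ) ≤
      ∑ x : ZMod p, ∏ j ∈ Finset.Icc 1 h, (1 + quadraticChar (ZMod p) (c * (x + (j : ℕ)))) := by
    rw [mul_comm, ← nsmul_eq_mul, ← Finset.sum_const, residueShifts, Finset.sum_filter]
    refine Finset.sum_le_sum fun x _ => ?_
    split_ifs with hx
    · rw [Finset.prod_congr rfl fun j hj => by rw [hx j hj]]
      simp
    · refine Finset.prod_nonneg fun j _ => ?_
      rcases quadraticChar_isQuadratic (ZMod p) (c * (x + (j : ℕ))) with h | h | h <;> rw [h] <;>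
        norm_num
  have hexp : ∑ x : ZMod p, ∏ j ∈ Finset.Icc 1 h,
        (1 + quadraticChar (ZMod p) (c * (x + (j : ℕ)))) =
      ∑ S ∈ (Finset.Icc 1 h).powerset, ∑ x : ZMod p, ∏ j ∈ S,
        quadraticChar (ZMod p) (c * (x + (j : ℕ))) := by
    rw [Finset.sum_comm]
    exact Finset.sum_congr rfl fun x _ => Finset.prod_one_add _
  rw [hexp, ← Finset.add_sum_erase _ _ (Finset.empty_mem_powerset _)] at hlow
  have hlow' : 2 ^ h * ((residueShifts p h c).card : ℝ) ≤
      p + ∑ S ∈ (Finset.Icc 1 h).powerset.erase ∅, ((∑ x : ZMod p, ∏ j ∈ S,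
        quadraticChar (ZMod p) (c * (x + (j : ℕ))) : ℤ) : ℝ) := by
    simp only [Finset.prod_empty, Finset.sum_const, Finset.card_univ, ZMod.card, nsmul_eq_mul,
      mul_one] at hlow
    exact_mod_cast hlow
  refine hlow'.trans (add_le_add le_rfl ?_)
  have hcard : (((Finset.Icc 1 h).powerset.erase ∅).card : ℝ) ≤ 2 ^ h := by
    have : ((Finset.Icc 1 h).powerset.erase ∅).card ≤ 2 ^ h := by
      refine (Finset.card_erase_le).trans ?_
      simp
    exact_mod_cast this
  calc _ ≤ ((Finset.Icc 1 h).powerset.erase ∅).card • (23 * h * Real.sqrt p) := by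
        refine Finset.sum_le_card_nsmul _ _ _ fun S hS => ?_
        rw [Finset.mem_erase, Finset.mem_powerset] at hS
        exact sum_quadraticChar_prod_le hp hh hc hS.2 (Finset.nonempty_iff_ne_empty.mpr hS.1)
    _ ≤ _ := by
        rw [nsmul_eq_mul]
        gcongr

/-! ### Counting coprime pairs -/

theorem card_filter_dvd_add_mul_le {u w : ℤ} (huw : IsCoprime u w) (L : ℕ) {l : ℕ} :
    ((Finset.range L).filter fun i : ℕ => (l : ℤ) ∣ u + i * w).card ≤ L / l + 1 := by
  rw [← Finset.card_range (L / l + 1)]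
  refine Finset.card_le_card_of_injOn (fun i => i / l) ?_ ?_
  · intro i hi
    have hi := Finset.mem_range.mp (Finset.mem_filter.mp (Finset.mem_coe.mp hi)).1
    exact Finset.mem_coe.mpr (Finset.mem_range.mpr
      (Nat.lt_succ_of_le (Nat.div_le_div_right hi.le)))
  · intro i hi i' hi' h
    have h1 := (Finset.mem_filter.mp (Finset.mem_coe.mp hi)).2
    have h2 := (Finset.mem_filter.mp (Finset.mem_coe.mp hi')).2
    -- A divisor of u + iw is coprime to w, so the admissible i form a single class mod l.
    have hcop : IsCoprime (l : ℤ) w := by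
      obtain ⟨m, hm⟩ := h1
      have : IsCoprime (u + i * w) w := by simpa using huw
      rw [hm] at this
      exact this.of_mul_left_left
    have h3 : (l : ℤ) ∣ (i - i') := by
      refine hcop.dvd_of_dvd_mul_right ?_
      have := dvd_sub h1 h2
      convert this using 1
      ring
    have h4 : i' % l = i % l := (Nat.modEq_iff_dvd.mpr h3)
    rw [← Nat.div_add_mod i l, ← Nat.div_add_mod i' l, h4]
    simp only at h
    rw [h]

theorem sum_Icc_two_inv_sq_le (Q : ℕ) : ∑ l ∈ Finset.Icc 2 Q, ((l : ℝ) ^ 2)⁻¹ ≤ 3 / 4 := by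
  rcases lt_or_ge Q 2 with hQ | hQ
  · rw [Finset.Icc_eq_empty (by omega)]
    norm_num
  · rw [← Finset.add_sum_Ioc_eq_sum_Icc hQ]
    have h := sum_Ioc_inv_sq_le_sub (α := ℝ) two_ne_zero hQ
    have : (0 : ℝ) ≤ (Q : ℝ)⁻¹ := by positivity
    push_cast at h ⊢
    linarith

/-- A positive proportion of the pairs `(u + i * w, q)` is coprime. -/
theorem mul_le_card_coprime_pairs {u w : ℤ} (huw : IsCoprime u w) {L Q : ℕ} (hL : 6 * Q ≤ L) :
    L * Q ≤ 8 * ((Finset.range L ×ˢ Finset.Icc 1 Q).filter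
      fun z : ℕ × ℕ => Int.gcd (u + z.1 * w) z.2 = 1).card := by
  have hsub : ((Finset.range L ×ˢ Finset.Icc 1 Q).filter
      fun z : ℕ × ℕ => ¬ Int.gcd (u + z.1 * w) z.2 = 1) ⊆
      (Finset.Icc 2 Q).biUnion fun l => ((Finset.range L).filter fun i : ℕ =>
        (l : ℤ) ∣ u + i * w) ×ˢ ((Finset.Ioc 0 Q).filter fun q => l ∣ q) := by
    intro z hz
    rw [Finset.mem_filter, Finset.mem_product, Finset.mem_Icc] at hz
    obtain ⟨⟨h1, h2, h3⟩, h4⟩ := hz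
    rw [Finset.mem_biUnion]
    have hd : Int.gcd (u + z.1 * w) z.2 ∣ z.2 := by
      exact_mod_cast Int.gcd_dvd_right (u + z.1 * w) z.2
    have hle := Nat.le_of_dvd (by omega) hd
    have hpos := Nat.pos_of_dvd_of_pos hd (by omega)
    refine ⟨_, Finset.mem_Icc.mpr ⟨by omega, hle.trans h3⟩, ?_⟩
    rw [Finset.mem_product, Finset.mem_filter, Finset.mem_filter, Finset.mem_Ioc]
    exact ⟨⟨h1, Int.gcd_dvd_left _ _⟩, ⟨by omega, h3⟩, hd⟩
  -- Union bound over the gcd l ≥ 2. Since l ≤ Q ≤ L/6, the +1 costs a factor 7/6, and 7/6 · 3/4 =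
  -- 7/8.
  have hbad : (((Finset.range L ×ˢ Finset.Icc 1 Q).filter
      fun z : ℕ × ℕ => ¬ Int.gcd (u + z.1 * w) z.2 = 1).card : ℝ) ≤ 7 / 8 * (L * Q) := by
    calc _ ≤ ((∑ l ∈ Finset.Icc 2 Q, (L / l + 1) * (Q / l) : ℕ) : ℝ) := by
          norm_cast
          refine (Finset.card_le_card hsub).trans (Finset.card_biUnion_le.trans ?_)
          refine Finset.sum_le_sum fun l _ => ?_
          rw [Finset.card_product, Nat.Ioc_filter_dvd_card_eq_div]
          exact Nat.mul_le_mul_right _ (card_filter_dvd_add_mul_le huw L)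
      _ ≤ ∑ l ∈ Finset.Icc 2 Q, 7 / 6 * (L * Q) * ((l : ℝ) ^ 2)⁻¹ := by
          push_cast
          refine Finset.sum_le_sum fun l hl => ?_
          rw [Finset.mem_Icc] at hl
          have hl0 : (0 : ℝ) < l := by exact_mod_cast (by omega : 0 < l)
          have h1 : ((L / l : ℕ) : ℝ) ≤ L / l := Nat.cast_div_le
          have h2 : ((Q / l : ℕ) : ℝ) ≤ Q / l := Nat.cast_div_le
          have h3 : (1 : ℝ) ≤ 1 / 6 * (L / l) := by
            have : (6 * l : ℝ) ≤ L := by exact_mod_cast (by omega : 6 * l ≤ L)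
            rw [← mul_div_assoc, le_div_iff₀ hl0]
            linarith
          calc (((L / l : ℕ) : ℝ) + 1) * ((Q / l : ℕ) : ℝ) ≤ (7 / 6 * (L / l)) * (Q / l) := by
                gcongr
                linarith
            _ = _ := by field_simp
      _ = 7 / 6 * (L * Q) * ∑ l ∈ Finset.Icc 2 Q, ((l : ℝ) ^ 2)⁻¹ := by rw [Finset.mul_sum]
      _ ≤ 7 / 6 * (L * Q) * (3 / 4) := by
          gcongr
          exact sum_Icc_two_inv_sq_le Q
      _ = _ := by ring
  have htot := Finset.card_filter_add_card_filter_not (s := Finset.range L ×ˢ Finset.Icc 1 Q)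
    (fun z : ℕ × ℕ => Int.gcd (u + z.1 * w) z.2 = 1)
  rw [Finset.card_product, Finset.card_range, Nat.card_Icc, Nat.add_sub_cancel] at htot
  have htot' := congrArg (Nat.cast (R := ℝ)) htot
  push_cast at htot'
  have : (L * Q : ℝ) ≤ 8 * (((Finset.range L ×ˢ Finset.Icc 1 Q).filter
      fun z : ℕ × ℕ => Int.gcd (u + z.1 * w) z.2 = 1).card : ℝ) := by
    linarith
  exact_mod_cast this

end Runs

/-! ### Many distinct points from one long run -/

section Fractions

/-- Every residue `a` modulo `p` is a fraction `u / w` such that equalities modulo `p` between the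
fractions `(a + i) / q` with `i < L` and `1 ≤ q ≤ Q` lift to the integers. -/
theorem exists_coprime_lift {p L Q : ℕ} [Fact p.Prime] (a : ZMod p) (hQ : 1 ≤ Q)
    (hL1 : 1 ≤ L) (hL : 16 * (L * Q ^ 2) < p) :
    ∃ u w : ℤ, IsCoprime u w ∧ 0 < w ∧ ∀ i < L, ∀ i' < L, ∀ q ∈ Finset.Icc 1 Q,
      ∀ q' ∈ Finset.Icc 1 Q, (a + (i : ℕ)) * (q' : ℕ) = (a + (i' : ℕ)) * (q : ℕ) →
        (u + i * w) * q' = (u + i' * w) * q := by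
  have hp0 : (0 : ℝ) < p := by exact_mod_cast (Fact.out : p.Prime).pos
  -- With denominators up to 4Q, both |u|Q and 4Q · LQ fall below p/4, so the difference of the two
  -- sides, a multiple of p, must be 0.
  obtain ⟨r, hr, hrQ⟩ := Real.exists_rat_abs_sub_le_and_den_le ((a.val : ℝ) / p)
    (n := 4 * Q) (by omega)
  have hQL : Q ≤ L * Q ^ 2 := by nlinarith
  have hden : 0 < r.den := r.den_pos
  have hden' : (0 : ℝ) < r.den := by exact_mod_cast hden
  have hu : |(r.den : ℤ) * a.val - r.num * p| * (4 * Q + 1) ≤ p := by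
    have h1 : |(r.den : ℝ) * a.val - r.num * p| = |(a.val : ℝ) / p - r| * (r.den * p) := by
      have h0 : |(a.val : ℝ) / p - r| * (r.den * p) = |((a.val : ℝ) / p - r) * (r.den * p)| := by
        rw [abs_mul, abs_of_pos (mul_pos hden' hp0)]
      rw [h0]
      congr 1
      rw [Rat.cast_def r]
      field_simp
    have h2 : |(r.den : ℝ) * a.val - r.num * p| * (4 * Q + 1) ≤ p := by
      rw [h1]
      calc |(a.val : ℝ) / p - r| * (r.den * p) * (4 * Q + 1)
          ≤ 1 / (((4 * Q : ℕ) + 1) * r.den) * (r.den * p) * (4 * Q + 1) := by gcongr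
        _ = p := by
            push_cast
            field_simp
    exact_mod_cast h2
  refine ⟨(r.den : ℤ) * a.val - r.num * p, r.den, ?_, by exact_mod_cast hden, ?_⟩
  · have h1 : IsCoprime r.num r.den := Int.isCoprime_iff_nat_coprime.mpr (by simpa using r.reduced)
    have h2 : IsCoprime (p : ℤ) r.den := by
      rw [Nat.isCoprime_iff_coprime]
      exact (Nat.coprime_of_lt_prime hden.ne' (by omega) (Fact.out : p.Prime))
    have h3 : IsCoprime (-(r.num * p) + r.den * a.val) (r.den : ℤ) :=
      IsCoprime.add_mul_left_left (h1.mul_left h2).neg_left _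
    convert h3 using 1
    ring
  · intro i hi i' hi' q hq q' hq' h
    rw [Finset.mem_Icc] at hq hq'
    set u : ℤ := (r.den : ℤ) * a.val - r.num * p with hudef
    have hcast : (u : ZMod p) = r.den * a := by
      rw [hudef]
      push_cast
      rw [ZMod.natCast_zmod_val, CharP.cast_eq_zero (ZMod p) p, mul_zero, sub_zero]
    have hdvd : (p : ℤ) ∣ (u + i * r.den) * q' - (u + i' * r.den) * q := by
      rw [← ZMod.intCast_zmod_eq_zero_iff_dvd _ p]
      push_cast
      rw [hcast]
      linear_combination (r.den : ZMod p) * h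
    refine sub_eq_zero.mp (Int.eq_zero_of_abs_lt_dvd hdvd ?_)
    have e : (u + i * r.den) * q' - (u + i' * r.den) * q =
        u * (q' - q) + r.den * (i * q' - i' * q) := by ring
    have hb1 : |(q' : ℤ) - q| ≤ Q := by rw [abs_le]; constructor <;> omega
    have hb2 : |(i : ℤ) * q' - i' * q| ≤ L * Q := by
      have h1 : (i : ℤ) * q' ≤ L * Q := by
        exact_mod_cast Nat.mul_le_mul hi.le hq'.2
      have h2 : (i' : ℤ) * q ≤ L * Q := by
        exact_mod_cast Nat.mul_le_mul hi'.le hq.2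
      have h3 : (0 : ℤ) ≤ i * q' := by positivity
      have h4 : (0 : ℤ) ≤ i' * q := by positivity
      rw [abs_le]; constructor <;> linarith
    have hw : (r.den : ℤ) ≤ 4 * Q := by exact_mod_cast hrQ
    have hLz : 16 * ((L : ℤ) * Q ^ 2) < p := by exact_mod_cast hL
    rw [e]
    calc |u * (q' - q) + r.den * (i * q' - i' * q)|
        ≤ |u| * |(q' : ℤ) - q| + r.den * |(i : ℤ) * q' - i' * q| := by
          refine (abs_add_le _ _).trans (le_of_eq ?_)
          rw [abs_mul, abs_mul, abs_of_nonneg (by positivity : (0 : ℤ) ≤ r.den)]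
      _ ≤ |u| * Q + 4 * Q * (L * Q) := by gcongr
      _ < p := by nlinarith [abs_nonneg u]

theorem eq_of_coprime_of_mul_eq {n n' : ℤ} {q q' : ℕ} (h : Int.gcd n q = 1)
    (h' : Int.gcd n' q' = 1) (hq : 0 < q) (he : n * q' = n' * q) : q = q' ∧ n = n' := by
  have h1 : (q : ℤ) ∣ q' := by
    refine (Int.isCoprime_iff_gcd_eq_one.mpr h).symm.dvd_of_dvd_mul_left ?_
    rw [he]
    exact dvd_mul_left _ _
  have h2 : (q' : ℤ) ∣ q := by
    refine (Int.isCoprime_iff_gcd_eq_one.mpr h').symm.dvd_of_dvd_mul_left ?_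
    rw [← he]
    exact dvd_mul_left _ _
  have hqq : q = q' := Nat.dvd_antisymm (by exact_mod_cast h1) (by exact_mod_cast h2)
  subst hqq
  exact ⟨rfl, mul_right_cancel₀ (by exact_mod_cast hq.ne') he⟩

/-- A long run of residues produces many points that start shorter runs of constant quadratic
character. -/
theorem mul_le_card_residueShifts {p h L Q : ℕ} [Fact p.Prime] {a n : ZMod p}
    (hrun : ∀ i < L + h * Q, quadraticChar (ZMod p) (a + (i : ℕ)) = 1)
    (hn : quadraticChar (ZMod p) n = -1) (hQ : 1 ≤ Q) (hLQ : 6 * Q ≤ L)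
    (hL : 16 * (L * Q ^ 2) < p) :
    L * Q ≤ 8 * ((residueShifts p h 1).card + (residueShifts p h n).card) := by
  classical
  obtain ⟨u, w, huw, hw, hlift⟩ := exists_coprime_lift a hQ (by omega) hL
  refine (mul_le_card_coprime_pairs huw hLQ).trans (Nat.mul_le_mul_left 8 ?_)
  have hq0 : ∀ q ∈ Finset.Icc 1 Q, (q : ZMod p) ≠ 0 := by
    intro q hq h0
    rw [ZMod.natCast_eq_zero_iff] at h0
    rw [Finset.mem_Icc] at hq
    have := Nat.le_of_dvd (by omega) h0
    nlinarith
  refine le_trans ?_ (Finset.card_union_le _ _)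
  -- The sign χ(q) decides whether the point lands in the set for c = 1 or for the nonresidue c = n.
  -- Injectivity is uniqueness of reduced fractions after lifting to ℤ.
  refine Finset.card_le_card_of_injOn (fun z : ℕ × ℕ => (a + (z.1 : ZMod p)) / (z.2 : ZMod p)) ?_ ?_
  · rintro ⟨i, q⟩ hz
    obtain ⟨hz, -⟩ := Finset.mem_filter.mp (Finset.mem_coe.mp hz)
    obtain ⟨hi, hq⟩ := Finset.mem_product.mp hz
    rw [Finset.mem_range] at hi
    simp only at hi hq
    have hχ : ∀ j ∈ Finset.Icc 1 h, quadraticChar (ZMod p) q *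
        quadraticChar (ZMod p) ((a + (i : ZMod p)) / q + (j : ℕ)) = 1 := by
      intro j hj
      rw [← map_mul]
      have e : (q : ZMod p) * ((a + (i : ZMod p)) / q + (j : ℕ)) = a + ((i + j * q : ℕ)) := by
        have := hq0 q hq
        push_cast
        field_simp
        ring
      rw [e]
      refine hrun _ ?_
      rw [Finset.mem_Icc] at hj hq
      exact add_lt_add_of_lt_of_le hi (Nat.mul_le_mul hj.2 hq.2)
    rw [Finset.mem_coe, Finset.mem_union, mem_residueShifts, mem_residueShifts]
    rcases quadraticChar_dichotomy (hq0 q hq) with h1 | h1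
    · left
      intro j hj
      have := hχ j hj
      rw [h1] at this
      rwa [map_mul, map_one]
    · right
      intro j hj
      have := hχ j hj
      rw [h1] at this
      rwa [map_mul, hn]
  · rintro ⟨i, q⟩ hz ⟨i', q'⟩ hz' he
    obtain ⟨hz, hg⟩ := Finset.mem_filter.mp (Finset.mem_coe.mp hz)
    obtain ⟨hi, hq⟩ := Finset.mem_product.mp hz
    obtain ⟨hz', hg'⟩ := Finset.mem_filter.mp (Finset.mem_coe.mp hz')
    obtain ⟨hi', hq'⟩ := Finset.mem_product.mp hz'
    simp only at hi hq hi' hq' he hg hg'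
    rw [div_eq_div_iff (hq0 q hq) (hq0 q' hq')] at he
    have h1 := hlift i (Finset.mem_range.mp hi) i' (Finset.mem_range.mp hi') q hq q' hq' he
    obtain ⟨h2, h3⟩ := eq_of_coprime_of_mul_eq hg hg' (Finset.mem_Icc.mp hq).1 h1
    have h4 : (i : ℤ) = i' := mul_right_cancel₀ hw.ne' (add_left_cancel h3)
    rw [Prod.mk.injEq]
    exact ⟨by exact_mod_cast h4, h2⟩

/-! ### Comparing the two counts -/

/-- Take Q = T and L = 2000hT, so L + hQ = 2001hT. As √p ≤ 4T², the upper count is at most 16(1 +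
92hT²) ≤ 1488hT², below LQ = 2000hT². -/
theorem not_run_of_large {p h T : ℕ} [Fact p.Prime] (hp : p ≠ 2) (hh1 : 1 ≤ h) (hph : p ≤ 2 ^ h)
    (hT : 1 ≤ T) (hhT : 32000 * (h * T ^ 3) < p) (hpT : p ≤ (T + 1) ^ 4) (a : ZMod p) :
    ¬ ∀ i < 2001 * (h * T), quadraticChar (ZMod p) (a + (i : ℕ)) = 1 := by
  intro hrun
  obtain ⟨n, hn⟩ := quadraticChar_exists_neg_one (F := ZMod p) (by rwa [ZMod.ringChar_zmod_n])
  have hn0 : n ≠ 0 := by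
    rintro rfl
    simp at hn
  have hhp : h < p := by nlinarith [Nat.one_le_pow 3 T hT]
  have hlow := mul_le_card_residueShifts (L := 2000 * (h * T)) (h := h) (Q := T) (a := a)
    (fun i hi => hrun i (by linarith)) hn hT (by nlinarith) (by
      refine lt_of_le_of_lt (le_of_eq ?_) hhT
      ring)
  have hupper : ∀ c : ZMod p, c ≠ 0 →
      ((residueShifts p h c).card : ℝ) ≤ 1 + 23 * h * Real.sqrt p := by
    intro c hc
    have h1 := card_residueShifts_le hp hhp hc
    have h2 : (p : ℝ) ≤ 2 ^ h := by exact_mod_cast hph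
    have h3 : (0 : ℝ) < 2 ^ h := by positivity
    refine le_of_mul_le_mul_left ?_ h3
    linarith
  have hu1 := hupper 1 one_ne_zero
  have hu2 := hupper n hn0
  have hlow' : 2000 * ((h : ℝ) * T) * T ≤
      8 * ((residueShifts p h 1).card + (residueShifts p h n).card) := by exact_mod_cast hlow
  have hT' : (1 : ℝ) ≤ T := by exact_mod_cast hT
  have hh' : (1 : ℝ) ≤ h := by exact_mod_cast hh1
  have hsq : Real.sqrt p ≤ 4 * (T : ℝ) ^ 2 := by
    rw [Real.sqrt_le_left (by positivity)]
    have h1 : (p : ℝ) ≤ (T + 1) ^ 4 := by exact_mod_cast hpT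
    refine h1.trans ?_
    have h2 : (T : ℝ) + 1 ≤ 2 * T := by linarith
    calc ((T : ℝ) + 1) ^ 4 ≤ (2 * (T : ℝ)) ^ 4 := by gcongr
      _ = (4 * (T : ℝ) ^ 2) ^ 2 := by ring
  have h5 : (h : ℝ) * Real.sqrt p ≤ h * (4 * T ^ 2) := by gcongr
  have h6 : (1 : ℝ) ≤ h * T ^ 2 := one_le_mul_of_one_le_of_one_le hh' (one_le_pow₀ hT')
  nlinarith

/-- For h = ⌊log₂ p⌋ + 1 and T = ⌊p^{1/4}⌋ this forces 32000h < T, hence 32000hT³ < T⁴ ≤ p. -/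
theorem pow_four_lt_two_pow {h : ℕ} (hh : 200 ≤ h) : (32002 * h) ^ 4 < 2 ^ (h - 1) := by
  induction h, hh using Nat.le_induction with
  | base => norm_num
  | succ h hh ih =>
    obtain ⟨k, rfl⟩ : ∃ k, h = k + 1 := ⟨h - 1, by omega⟩
    have h1 : (k + 1 + 1) ^ 4 ≤ 2 * (k + 1) ^ 4 := by
      have h2 : (k + 1 + 1) ^ 2 * 10 ≤ 14 * (k + 1) ^ 2 := by nlinarith
      have h3 := Nat.mul_le_mul h2 h2
      nlinarith
    rw [Nat.add_sub_cancel] at ih ⊢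
    rw [pow_succ 2 k]
    calc (32002 * (k + 1 + 1)) ^ 4 = 32002 ^ 4 * (k + 1 + 1) ^ 4 := by rw [mul_pow]
      _ ≤ 32002 ^ 4 * (2 * (k + 1) ^ 4) := Nat.mul_le_mul_left _ h1
      _ = (32002 * (k + 1)) ^ 4 * 2 := by rw [mul_pow]; ring
      _ < 2 ^ k * 2 := Nat.mul_lt_mul_of_pos_right ih two_pos

end Fractions

theorem longestResidueRun_lt_of_large {p : ℕ} (hp : p.Prime) (hlarge : 2 ^ 200 ≤ p) :
    longestResidueRun p < 2001 * ((Nat.log 2 p + 1) * p.sqrt.sqrt) := by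
  have : Fact p.Prime := ⟨hp⟩
  have hp2 : p ≠ 2 := by
    rintro rfl
    norm_num at hlarge
  have hlog : 200 ≤ Nat.log 2 p := Nat.le_log_of_pow_le one_lt_two hlarge
  have h1 : 2 ^ Nat.log 2 p ≤ p := Nat.pow_log_le_self 2 hp.ne_zero
  have h2 : p < 2 ^ (Nat.log 2 p + 1) := Nat.lt_pow_succ_log_self one_lt_two p
  have h3 := pow_four_lt_two_pow (h := Nat.log 2 p + 1) (by omega)
  rw [Nat.add_sub_cancel] at h3
  have h4 : p ≤ (p.sqrt.sqrt + 1) ^ 4 := by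
    have a1 := Nat.lt_succ_sqrt' p
    have a2 := Nat.lt_succ_sqrt' p.sqrt
    calc p ≤ (p.sqrt + 1) ^ 2 := a1.le
      _ ≤ ((p.sqrt.sqrt + 1) ^ 2) ^ 2 := Nat.pow_le_pow_left a2 2
      _ = _ := by rw [← pow_mul]
  have h5 : p.sqrt.sqrt ^ 4 ≤ p := by
    calc p.sqrt.sqrt ^ 4 = (p.sqrt.sqrt ^ 2) ^ 2 := by rw [← pow_mul]
      _ ≤ p.sqrt ^ 2 := Nat.pow_le_pow_left (Nat.sqrt_le' _) 2
      _ ≤ p := Nat.sqrt_le' p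
  have h6 : 32002 * (Nat.log 2 p + 1) < p.sqrt.sqrt + 1 :=
    lt_of_pow_lt_pow_left₀ 4 (by omega) (h3.trans_le (h1.trans h4))
  by_contra! hle
  obtain ⟨a, ha⟩ := (longestResidueRun_isGreatest p hp).1
  refine not_run_of_large hp2 (by omega) h2.le (by omega) ?_ h4 a fun i hi => ?_
  · refine lt_of_lt_of_le ?_ h5
    have : 0 < p.sqrt.sqrt ^ 3 := pow_pos (by omega) 3
    calc 32000 * ((Nat.log 2 p + 1) * p.sqrt.sqrt ^ 3)
        = (32000 * (Nat.log 2 p + 1)) * p.sqrt.sqrt ^ 3 := by ring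
      _ < p.sqrt.sqrt * p.sqrt.sqrt ^ 3 := Nat.mul_lt_mul_of_pos_right (by omega) this
      _ = p.sqrt.sqrt ^ 4 := by ring
  · obtain ⟨x, hx, hx2⟩ := ha i (hi.trans_le hle)
    rw [hx2]
    exact quadraticChar_sq_one' hx

theorem longestResidueRun_le {p : ℕ} (hp : p.Prime) : longestResidueRun p ≤ p := by
  have : Fact p.Prime := ⟨hp⟩
  obtain ⟨a, ha⟩ := (longestResidueRun_isGreatest p hp).1
  by_contra! hlt
  obtain ⟨x, hx, hx2⟩ := ha (-a).val ((ZMod.val_lt (-a)).trans hlt)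
  rw [ZMod.natCast_zmod_val, add_neg_cancel] at hx2
  exact pow_ne_zero 2 hx hx2.symm

theorem theoremt :
    ∃ C : ℝ, 0 < C ∧ ∀ p : ℕ, p.Prime →
      (longestResidueRun p : ℝ) ≤ C * (p : ℝ) ^ (1 / 4 : ℝ) * Real.logb 2 (p : ℝ) := by
  -- The constant absorbs all p < 2^200 through d(p) ≤ p; larger p need only 4002.
  refine ⟨2 ^ 200, by positivity, fun p hp => ?_⟩
  have hp2 : (2 : ℝ) ≤ p := by exact_mod_cast hp.two_le
  have hroot : (1 : ℝ) ≤ (p : ℝ) ^ (1 / 4 : ℝ) :=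
    Real.one_le_rpow (by linarith) (by norm_num)
  have hlog1 : 1 ≤ Real.logb 2 (p : ℝ) := by
    rw [Real.le_logb_iff_rpow_le one_lt_two (by linarith), Real.rpow_one]
    exact hp2
  rcases lt_or_ge p (2 ^ 200) with hsmall | hlarge
  · calc (longestResidueRun p : ℝ) ≤ 2 ^ 200 := by
          exact_mod_cast (longestResidueRun_le hp).trans hsmall.le
      _ = 2 ^ 200 * 1 * 1 := by ring
      _ ≤ _ := by gcongr
  · have h1 : (longestResidueRun p : ℝ) ≤ 2001 * ((Nat.log 2 p + 1) * p.sqrt.sqrt) := by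
      exact_mod_cast (longestResidueRun_lt_of_large hp hlarge).le
    have h2 : (Nat.log 2 p : ℝ) ≤ Real.logb 2 p := by
      exact_mod_cast Real.natLog_le_logb p 2
    have h3 : (p.sqrt.sqrt : ℝ) ≤ (p : ℝ) ^ (1 / 4 : ℝ) := by
      calc (p.sqrt.sqrt : ℝ) ≤ Real.sqrt (p.sqrt) := Real.nat_sqrt_le_real_sqrt
        _ ≤ Real.sqrt (Real.sqrt p) := Real.sqrt_le_sqrt Real.nat_sqrt_le_real_sqrt
        _ = (p : ℝ) ^ (1 / 4 : ℝ) := by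
            rw [Real.sqrt_eq_rpow, Real.sqrt_eq_rpow, ← Real.rpow_mul (by linarith)]
            norm_num
    calc (longestResidueRun p : ℝ) ≤ 2001 * ((Nat.log 2 p + 1) * p.sqrt.sqrt) := h1
      _ ≤ 2001 * ((Real.logb 2 p + Real.logb 2 p) * (p : ℝ) ^ (1 / 4 : ℝ)) := by gcongr
      _ = 4002 * (p : ℝ) ^ (1 / 4 : ℝ) * Real.logb 2 p := by ring
      _ ≤ 2 ^ 200 * (p : ℝ) ^ (1 / 4 : ℝ) * Real.logb 2 p := by
          gcongr
          norm_num
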